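/- Let $R\ge 1$ and $I_1,\dots,I_4\ge 1$, and let $\alpha,a_\tau,b_\tau,a_\lambda,b_\lambda>0$ (for instance $a_\tau=\alpha R$, $b_\tau=\alpha R^{1/4}$). For $h=1,\dots,4$ and $r=1,\dots,R$ let $\boldsymbol\beta_h^{(r)}\in\mathbb R^{I_h}$ be the marginals of the PARAFAC($R$) tensor $\mathcal B=\sum_{r=1}^R\boldsymbol\beta_1^{(r)}\circ\boldsymbol\beta_2^{(r)}\circ\boldsymbol\beta_3^{(r)}\circ\boldsymbol\beta_4^{(r)}$, with the hierarchical global--local prior (Gamma laws in shape--rate form) $$\boldsymbol\phi\sim\mathrm{Dir}(\alpha,\dots,\alpha),\quad \tau\sim\mathrm{Ga}(a_\tau,b_\tau),\quad \lambda_{h,r}\sim\mathrm{Ga}(a_\lambda,b_\lambda),\quad w_{h,r,l}\mid\lambda_{h,r}\sim\mathrm{Exp}(\lambda_{h,r}^2/2),$$ $$\boldsymbol\beta_h^{(r)}\mid \mathbf W,\boldsymbol\phi,\tau\ \sim\ \mathcal N_{I_h}(\mathbf 0,\tau\phi_r W_{h,r}),\qquad W_{h,r}=\mathrm{diag}(w_{h,r,1},\dots,w_{h,r,I_h}),$$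 where $\boldsymbol\phi$, $\tau$ and $(\lambda,w)$ are independent, the $\lambda_{h,r}$ are independent, the $w_{h,r,l}$ are conditionally independent given $\lambda$, and the $\boldsymbol\beta_h^{(r)}$ are conditionally independent given $(\tau,\boldsymbol\phi,\mathbf W)$. Fix $(i,j,k,p)$, put $(m_1,m_2,m_3,m_4)=(i,j,k,p)$, and write the entry $b_{ijkp}$ of $\mathcal B$ as $b_{ijkp}=\sum_{r=1}^R\beta_r$ with $\beta_r=\prod_{h=1}^4\beta^{(r)}_{h,m_h}$. Then, for almost every value of $(\tau,\boldsymbol\phi,\mathbf W)$, all of $\tau$, $\phi_r$, $w_{h,r,l}$ are positive, and the conditional law of $b_{ijkp}$ given $(\tau,\boldsymbol\phi,\mathbf W)$ is the convolution of the conditional laws of $\beta_1,\dots,\beta_R$; it has the density $$\pi(\cdot\mid\tau,\boldsymbol\phi,\mathbf W)=p_1*\dots*p_R ,$$ where $p_r$, the conditional density of $\beta_r$ given $(\tau,\boldsymbol\phi,\mathbf W)$, is, for $x\neq0$, $$p_r(x)=K_r\; G^{4,0}_{0,4}\Bigl(x^2\prod_{h=1}^4(2\tau\phi_r w_{h,r,m_h})^{-1}\Bigm|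 0,0,0,0\Bigr),\qquad K_r=(2\pi)^{-4/2}\prod_{h=1}^4(\tau\phi_r w_{h,r,m_h})^{-1/2}.$$ Here $G^{4,0}_{0,4}$ is the Meijer G-function $$G^{4,0}_{0,4}(y\mid 0,0,0,0)=\frac1{2\pi i}\int_{c-i\infty}^{c+i\infty}\Gamma(s)^4\,y^{-s}\,ds\qquad(y>0),$$ where $c>0$ is arbitrary; the integral converges absolutely, and its value is real and nonnegative. -/

import Mathlib

open MeasureTheory ProbabilityTheory
open scoped ENNReal

/-- The integrand of the Mellin-Barnes integral, without the factor `y ^ (-s)`: the quotient of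
`∏_{j ≤ m} Γ(b_j + s) ∏_{j ≤ n} Γ(1 - a_j - s)` by
`∏_{j > n} Γ(a_j + s) ∏_{j > m} Γ(1 - b_j - s)`, where `a` has `p` and `b` has `q` entries. -/
noncomputable def meijerKernel {p q : ℕ} (m n : ℕ) (a : Fin p → ℂ) (b : Fin q → ℂ) (s : ℂ) : ℂ :=
  (∏ j : Fin q, if (j : ℕ) < m then Complex.Gamma (b j + s) else (Complex.Gamma (1 - b j - s))⁻¹) *
    ∏ j : Fin p, if (j : ℕ) < n then Complex.Gamma (1 - a j - s) else (Complex.Gamma (a j + s))⁻¹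

/-- The Meijer G-function `G_{p,q}^{m,n}(y | a ; b)` at `y > 0`, as the Mellin-Barnes integral
`(1 / 2πi) ∫_{c - i∞}^{c + i∞} meijerKernel m n a b s * y ^ (-s) ds` along the line `Re s = c`.
The line has to separate the poles of the `Γ(b_j + s)` (on its left) from those of the
`Γ(1 - a_j - s)` (on its right); when `p = 0` and `b = 0` this means `c > 0`. -/
noncomputable def meijerG {p q : ℕ} (m n : ℕ) (a : Fin p → ℂ) (b : Fin q → ℂ) (c y : ℝ) : ℂ :=
  mellinInv c (meijerKernel m n a b) y

/-- The Meijer G-function `G_{0,4}^{4,0}(y | 0, 0, 0, 0)`, integrated along `Re s = c`. -/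
noncomputable def meijerG₄ (c y : ℝ) : ℂ :=
  meijerG 4 0 (fun j : Fin 0 => j.elim0) (fun _ : Fin 4 => 0) c y

/-- The constant `K = (2π)^(-4/2) ∏_h v_h^(-1/2)`, for variances `v_1, …, v_4`. -/
noncomputable def productNormalConst (v : Fin 4 → ℝ) : ℝ :=
  (2 * Real.pi) ^ (-(4 / 2) : ℝ) * ∏ h, v h ^ (-(1 / 2) : ℝ)

/-- The function `x ↦ K * G_{0,4}^{4,0}(x² ∏_h (2 v_h)⁻¹ | 0, 0, 0, 0)`. -/
noncomputable def productNormalDensity (c : ℝ) (v : Fin 4 → ℝ) (x : ℝ) : ℝ :=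
  productNormalConst v * (meijerG₄ c (x ^ 2 * ∏ h, (2 * v h)⁻¹)).re

/-- The iterated convolution `μ₁ ∗ ⋯ ∗ μ_R` of a list of measures on `ℝ`. -/
noncomputable def measureConvList (L : List (Measure ℝ)) : Measure ℝ :=
  L.foldr Measure.conv (Measure.dirac 0)

/-- The iterated convolution `f₁ ∗ ⋯ ∗ f_R` of a nonempty list of densities on `ℝ`
(the value on the empty list is a dummy). -/
noncomputable def densityConvList : List (ℝ → ℝ≥0∞) → ℝ → ℝ≥0∞
  | [] => 0
  | [f] => f
  | f :: g :: L => lconvolution f (densityConvList (g :: L)) volume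

/-- The Dirichlet distribution with parameters `a_1, …, a_R`: the law of `X / ∑ r, X_r` where the
`X_r` are independent with laws `Gamma(a_r, 1)`. -/
noncomputable def dirichletMeasure {R : ℕ} (a : Fin R → ℝ) : Measure (Fin R → ℝ) :=
  (Measure.pi fun r => gammaMeasure (a r) 1).map fun x r => x r / ∑ s, x s

/-- A family of PARAFAC marginals `β_h^{(r)} ∈ ℝ^{I_h}`, for `h = 1, …, 4` and `r = 1, …, R`. -/
abbrev ParafacMarginals (R : ℕ) (I : Fin 4 → ℕ) : Type :=
  (h : Fin 4) → Fin R → EuclideanSpace ℝ (Fin (I h))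

/-- A family of local scales `w_{h,r,p}`; the diagonal of `W_{h,r}` is `w h r`. -/
abbrev LocalScales (R : ℕ) (I : Fin 4 → ℕ) : Type :=
  (h : Fin 4) → Fin R → Fin (I h) → ℝ

/-- The `r`-th summand `∏_h β_{h,m_h}^{(r)}` of the entry at `m = (m_1, …, m_4)`. -/
noncomputable def parafacSummand {R : ℕ} {I : Fin 4 → ℕ} (m : (h : Fin 4) → Fin (I h))
    (β : ParafacMarginals R I) (r : Fin R) : ℝ :=
  ∏ h, β h r (m h)

/-- The entry at `m` of the tensor `∑_r β_1^{(r)} ∘ β_2^{(r)} ∘ β_3^{(r)} ∘ β_4^{(r)}`. -/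
noncomputable def parafacEntry {R : ℕ} {I : Fin 4 → ℕ} (m : (h : Fin 4) → Fin (I h))
    (β : ParafacMarginals R I) : ℝ :=
  ∑ r, parafacSummand m β r

/-- The hierarchical global-local prior: the random variables `φ`, `τ`, `lam`, `w`, `β` satisfy
`φ ∼ Dir(α, …, α)`, `τ ∼ Ga(aτ, bτ)`, `lam_{h,r} ∼ Ga(al, bl)` (shape and rate),
`w_{h,r,p} | lam ∼ Exp(lam_{h,r}² / 2)` and `β_h^{(r)} | τ, φ, W ∼ N(0, τ φ_r W_{h,r})`, with
independence within each level, and with `φ`, `τ` and the pair `(lam, w)` independent. -/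
structure IsGlobalLocalPrior {Ω : Type*} [MeasurableSpace Ω] (P : Measure Ω)
    [IsProbabilityMeasure P] {R : ℕ} {I : Fin 4 → ℕ} (α aτ bτ al bl : ℝ)
    (φ : Ω → Fin R → ℝ) (τ : Ω → ℝ) (lam : Ω → Fin 4 → Fin R → ℝ)
    (w : Ω → LocalScales R I) (β : Ω → ParafacMarginals R I) : Prop where
  measurable_φ : Measurable φ
  measurable_τ : Measurable τ
  measurable_lam : Measurable lam
  measurable_w : Measurable w
  measurable_β : Measurable β
  law_φ : P.map φ = dirichletMeasure fun _ => α
  law_τ : P.map τ = gammaMeasure aτ bτ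
  law_lam : P.map lam = Measure.pi fun _ => Measure.pi fun _ => gammaMeasure al bl
  indep_φ_τ : IndepFun φ τ P
  indep_global_local : IndepFun (fun ω => (φ ω, τ ω)) (fun ω => (lam ω, w ω)) P
  law_w : ∀ᵐ l ∂(P.map lam), condDistrib w lam P l =
    Measure.pi fun h => Measure.pi fun r => Measure.pi fun _ => expMeasure (l h r ^ 2 / 2)
  law_β : ∀ᵐ θ ∂(P.map fun ω => (τ ω, φ ω, w ω)),
    condDistrib β (fun ω => (τ ω, φ ω, w ω)) P θ =
      Measure.pi fun h => Measure.pi fun r =>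
        multivariateGaussian 0 ((θ.1 * θ.2.1 r) • Matrix.diagonal (θ.2.2 h r))

/-!
The density of a centred Gaussian variable is a function of `x ^ 2`, so the density of a product of
independent ones is a multiplicative convolution evaluated at `x ^ 2`. Up to scaling this is the
`d`-fold multiplicative convolution of `e ^ (-u)`, whose Mellin transform is `Γ(s) ^ d`. In the
coordinate `log u` it becomes the additive convolution of an integrable and a bounded continuous
function; hence it is continuous, and since `Γ` decays at least quadratically on vertical lines,
Mellin inversion identifies it with the Mellin-Barnes integral defining the Meijer G-function.
In particular this integral is real and nonnegative. Conditionally on the scales, the coordinates of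
the marginals are independent centred Gaussian variables, so the summands of the entry are
independent products of this kind and the law of the entry is the convolution of theirs.
-/

open Set Filter Topology
open scoped Convolution

/-- The multiplicative convolution of two functions on `(0, ∞)`, with respect to the Haar measure
`du / u`; the Mellin transform turns it into a product. -/
noncomputable def mellinConv {𝕜 : Type*} [RCLike 𝕜] (f g : ℝ → 𝕜) (y : ℝ) : 𝕜 :=
  ∫ u in Ioi 0, u⁻¹ • (f u * g (y / u))

/-- The integral defining `mellinConv f g y` converges absolutely. -/
def MellinConvExistsAt {𝕜 : Type*} [RCLike 𝕜] (f g : ℝ → 𝕜) (y : ℝ) : Prop :=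
  IntegrableOn (fun u => u⁻¹ • (f u * g (y / u))) (Ioi 0)

/-- The integrand of the Mellin transform of `f` at `s` in the logarithmic coordinate `x = log u`.
It turns multiplicative into additive convolutions. -/
noncomputable def mellinLogIntegrand (f : ℝ → ℂ) (s : ℂ) (x : ℝ) : ℂ :=
  Complex.exp (s * x) * f (Real.exp x)

section Scaling

variable {𝕜 : Type*} [RCLike 𝕜] {f g : ℝ → 𝕜} {a b y : ℝ}

lemma mellinConv_const_mul (k l : 𝕜) (y : ℝ) :
    mellinConv (fun u => k * f u) (fun u => l * g u) y = k * l * mellinConv f g y := by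
  simp only [mellinConv, ← integral_const_mul, mul_mul_mul_comm k, mul_smul_comm]

lemma MellinConvExistsAt.const_mul (h : MellinConvExistsAt f g y) (k l : 𝕜) :
    MellinConvExistsAt (fun u => k * f u) (fun u => l * g u) y := by
  simpa only [MellinConvExistsAt, mul_mul_mul_comm k, mul_smul_comm] using!
    Integrable.const_mul h (k * l)

lemma inv_smul_comp_mul_left_mul (ha : a ≠ 0) (u : ℝ) :
    u⁻¹ • (f (a * u) * g (b * (y / u))) =
      a • ((a * u)⁻¹ • (f (a * u) * g (a * b * y / (a * u)))) := by
  rw [smul_smul, mul_inv, mul_inv_cancel_left₀ ha, mul_assoc a, mul_div_mul_left _ _ ha,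
    mul_div_assoc]

lemma mellinConv_comp_mul_left (ha : 0 < a) :
    mellinConv (fun u => f (a * u)) (fun u => g (b * u)) y = mellinConv f g (a * b * y) := by
  simp only [mellinConv, inv_smul_comp_mul_left_mul ha.ne', integral_smul]
  rw [integral_comp_mul_left_Ioi (fun u => u⁻¹ • (f u * g (a * b * y / u))) 0 ha, mul_zero,
    smul_inv_smul₀ ha.ne']

lemma MellinConvExistsAt.comp_mul_left (ha : 0 < a) (h : MellinConvExistsAt f g (a * b * y)) :
    MellinConvExistsAt (fun u => f (a * u)) (fun u => g (b * u)) y := by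
  simp only [MellinConvExistsAt, inv_smul_comp_mul_left_mul ha.ne']
  refine Integrable.smul a ((integrableOn_Ioi_comp_mul_left_iff
    (fun u => u⁻¹ • (f u * g (a * b * y / u))) 0 ha).2 ?_)
  rwa [mul_zero]

end Scaling

section MellinConv

variable {E : Type*} [NormedAddCommGroup E] [NormedSpace ℝ E]

lemma integrableOn_Ioi_inv_smul_iff_comp_exp {h : ℝ → E} :
    IntegrableOn (fun u => u⁻¹ • h u) (Ioi 0) ↔ Integrable fun x => h (Real.exp x) := by
  rw [← Real.range_exp, ← image_univ, integrableOn_image_iff_integrableOn_abs_deriv_smul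
    MeasurableSet.univ (fun x _ => (Real.hasDerivAt_exp x).hasDerivWithinAt)
    Real.exp_injective.injOn, integrableOn_univ]
  simp [smul_smul]

lemma setIntegral_Ioi_inv_smul_eq_integral_comp_exp (h : ℝ → E) :
    ∫ u in Ioi (0 : ℝ), u⁻¹ • h u = ∫ x, h (Real.exp x) := by
  rw [← Real.range_exp, ← image_univ, integral_image_eq_integral_abs_deriv_smul
    MeasurableSet.univ (fun x _ => (Real.hasDerivAt_exp x).hasDerivWithinAt)
    Real.exp_injective.injOn, setIntegral_univ]
  simp [smul_smul]

variable {f g : ℝ → ℂ} {s : ℂ}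

lemma cpow_sub_one_smul_eq_inv_smul {u : ℝ} (hu : 0 < u) (z : ℂ) :
    (u : ℂ) ^ (s - 1) • z = u⁻¹ • ((u : ℂ) ^ s * z) := by
  have hu' : (u : ℂ) ≠ 0 := by exact_mod_cast hu.ne'
  rw [Complex.cpow_sub _ _ hu', Complex.cpow_one, Complex.real_smul, smul_eq_mul]
  push_cast
  ring

lemma exp_cpow_mul_eq_mellinLogIntegrand (x : ℝ) :
    (Real.exp x : ℂ) ^ s * f (Real.exp x) = mellinLogIntegrand f s x := by
  rw [mellinLogIntegrand, Complex.cpow_def_of_ne_zero (by simp),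
    ← Complex.ofReal_log (Real.exp_nonneg x), Real.log_exp, mul_comm s]

lemma mellinConvergent_iff_integrable_mellinLogIntegrand :
    MellinConvergent f s ↔ Integrable (mellinLogIntegrand f s) := by
  rw [MellinConvergent, integrableOn_congr_fun
    (s := Ioi 0) (fun u hu => cpow_sub_one_smul_eq_inv_smul hu (f u)) measurableSet_Ioi,
    integrableOn_Ioi_inv_smul_iff_comp_exp]
  simp only [exp_cpow_mul_eq_mellinLogIntegrand]

lemma mellin_eq_integral_mellinLogIntegrand : mellin f s = ∫ x, mellinLogIntegrand f s x := by
  rw [mellin, setIntegral_congr_fun measurableSet_Ioi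
    (fun u hu => cpow_sub_one_smul_eq_inv_smul hu _),
    setIntegral_Ioi_inv_smul_eq_integral_comp_exp]
  simp only [exp_cpow_mul_eq_mellinLogIntegrand]

lemma mellinLogIntegrand_mul_mellinLogIntegrand_sub (x t : ℝ) :
    mellinLogIntegrand f s t * mellinLogIntegrand g s (x - t) =
      Complex.exp (s * x) * (f (Real.exp t) * g (Real.exp x / Real.exp t)) := by
  rw [mellinLogIntegrand, mellinLogIntegrand, Real.exp_sub, mul_mul_mul_comm, ← Complex.exp_add]
  push_cast
  ring_nf

lemma mellinLogIntegrand_mellinConv :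
    mellinLogIntegrand (mellinConv f g) s =
      mellinLogIntegrand f s ⋆[ContinuousLinearMap.mul ℂ ℂ] mellinLogIntegrand g s := by
  funext x
  simp only [convolution_def, ContinuousLinearMap.mul_apply',
    mellinLogIntegrand_mul_mellinLogIntegrand_sub, integral_const_mul]
  rw [mellinLogIntegrand, mellinConv, setIntegral_Ioi_inv_smul_eq_integral_comp_exp]

lemma hasMellin_mellinConv {a b : ℂ} (hf : HasMellin f s a) (hg : HasMellin g s b) :
    HasMellin (mellinConv f g) s (a * b) := by
  have hf' := mellinConvergent_iff_integrable_mellinLogIntegrand.1 hf.1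
  have hg' := mellinConvergent_iff_integrable_mellinLogIntegrand.1 hg.1
  refine ⟨mellinConvergent_iff_integrable_mellinLogIntegrand.2 ?_, ?_⟩
  · rw [mellinLogIntegrand_mellinConv]
    exact hf'.integrable_convolution _ hg'
  · rw [mellin_eq_integral_mellinLogIntegrand, mellinLogIntegrand_mellinConv,
      integral_convolution _ hf' hg', ← mellin_eq_integral_mellinLogIntegrand,
      ← mellin_eq_integral_mellinLogIntegrand, hf.2, hg.2]
    rfl

end MellinConv

section BoundedConvolution

variable {𝕜 G E E' F : Type*} [RCLike 𝕜] [NormedAddCommGroup E] [NormedAddCommGroup E']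
  [NormedAddCommGroup F] [NormedSpace 𝕜 E] [NormedSpace 𝕜 E'] [NormedSpace 𝕜 F]
  (L : E →L[𝕜] E' →L[𝕜] F) [AddCommGroup G] [TopologicalSpace G] [IsTopologicalAddGroup G]
  [SecondCountableTopology G] [MeasurableSpace G] [BorelSpace G] {μ : Measure G}
  {f : G → E}

lemma convolutionExists_boundedContinuousFunction [SFinite μ] [μ.IsAddLeftInvariant]
    (hf : Integrable f μ) (g : BoundedContinuousFunction G E') :
    ConvolutionExists f g L μ := fun _ =>
  BddAbove.convolutionExistsAt L (s := univ)
    (g.bddAbove_range_norm_comp.mono (image_subset_range _ _))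
    MeasurableSet.univ (subset_univ _) hf.integrableOn g.continuous.aestronglyMeasurable

lemma exists_boundedContinuousFunction_eq_convolution [NormedSpace ℝ F] (hf : Integrable f μ)
    (g : BoundedContinuousFunction G E') :
    ∃ h : BoundedContinuousFunction G F, ⇑h = f ⋆[L, μ] g := by
  have hcont : Continuous (f ⋆[L, μ] g) :=
    BddAbove.continuous_convolution_right_of_integrable L g.bddAbove_range_norm_comp hf
      g.continuous
  refine ⟨.ofNormedAddCommGroup _ hcont (∫ t, ‖L‖ * ‖f t‖ * ‖g‖ ∂μ) fun x => ?_, rfl⟩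
  exact norm_integral_le_of_norm_le ((hf.norm.const_mul _).mul_const _)
    (ae_of_all _ fun t => L.le_of_opNorm₂_le_of_le le_rfl le_rfl (g.norm_coe_le_norm _))

end BoundedConvolution

section MellinConvReal

variable {f g : ℝ → ℝ}

lemma ofReal_mellinConv (y : ℝ) :
    ((mellinConv f g y : ℝ) : ℂ) = mellinConv (fun u => (f u : ℂ)) (fun u => (g u : ℂ)) y := by
  simp [mellinConv, ← integral_complex_ofReal]

lemma mellinConv_nonneg (hf : ∀ u, 0 < u → 0 ≤ f u) (hg : ∀ u, 0 < u → 0 ≤ g u) {y : ℝ}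
    (hy : 0 < y) : 0 ≤ mellinConv f g y :=
  setIntegral_nonneg measurableSet_Ioi fun u hu =>
    smul_nonneg (inv_nonneg.2 (le_of_lt hu)) (mul_nonneg (hf u hu) (hg _ (div_pos hy hu)))

lemma measurable_mellinConv (hf : Measurable f) (hg : Measurable g) :
    Measurable (mellinConv f g) := by
  have h : Measurable fun p : ℝ × ℝ => p.2⁻¹ • (f p.2 * g (p.1 / p.2)) := by fun_prop
  exact (h.stronglyMeasurable.integral_prod_right (ν := volume.restrict (Ioi 0))).measurable

end MellinConvReal

/-- The iterated Mellin convolution `e^{-u} ∗ ⋯ ∗ e^{-u}` with `n + 1` factors; it is the function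
whose Mellin transform is `Γ(s) ^ (n + 1)`. -/
noncomputable def expMellinConvPow : ℕ → ℝ → ℝ
  | 0 => fun u => Real.exp (-u)
  | n + 1 => mellinConv (fun u => Real.exp (-u)) (expMellinConvPow n)

section ExpMellinConvPow

lemma measurable_expMellinConvPow (n : ℕ) : Measurable (expMellinConvPow n) := by
  induction n with
  | zero => exact Real.measurable_exp.comp measurable_neg
  | succ n ih => exact measurable_mellinConv (Real.measurable_exp.comp measurable_neg) ih

lemma expMellinConvPow_nonneg (n : ℕ) {y : ℝ} (hy : 0 < y) : 0 ≤ expMellinConvPow n y := by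
  induction n generalizing y with
  | zero => exact Real.exp_nonneg _
  | succ n ih => exact mellinConv_nonneg (fun _ _ => Real.exp_nonneg _) (fun _ => ih) hy

lemma hasMellin_exp_neg {s : ℂ} (hs : 0 < s.re) :
    HasMellin (fun u => (Real.exp (-u) : ℂ)) s (Complex.Gamma s) := by
  have h : ∀ u : ℝ, (Real.exp (-u) : ℂ) * (u : ℂ) ^ (s - 1) =
      (u : ℂ) ^ (s - 1) • (Real.exp (-u) : ℂ) := fun u => mul_comm _ _
  constructor
  · simpa only [h] using! Complex.GammaIntegral_convergent hs
  · rw [Complex.Gamma_eq_integral hs, Complex.GammaIntegral]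
    simp only [h, mellin]

lemma hasMellin_expMellinConvPow (n : ℕ) {s : ℂ} (hs : 0 < s.re) :
    HasMellin (fun y => (expMellinConvPow n y : ℂ)) s (Complex.Gamma s ^ (n + 1)) := by
  induction n with
  | zero =>
    rw [zero_add, pow_one]
    exact hasMellin_exp_neg hs
  | succ n ih =>
    simp only [expMellinConvPow, ofReal_mellinConv, pow_succ' _ (n + 1)]
    exact hasMellin_mellinConv (hasMellin_exp_neg hs) ih

lemma integrable_mellinLogIntegrand_exp_neg :
    Integrable (mellinLogIntegrand (fun u => (Real.exp (-u) : ℂ)) 1) :=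
  mellinConvergent_iff_integrable_mellinLogIntegrand.1 (hasMellin_exp_neg (by simp)).1

lemma exists_boundedContinuousFunction_eq_mellinLogIntegrand (n : ℕ) :
    ∃ G : BoundedContinuousFunction ℝ ℂ,
      ⇑G = mellinLogIntegrand (fun y => (expMellinConvPow n y : ℂ)) 1 := by
  induction n with
  | zero =>
    have h : mellinLogIntegrand (fun y => (expMellinConvPow 0 y : ℂ)) 1 =
        fun x : ℝ => ((Real.exp (x - Real.exp x) : ℝ) : ℂ) := by
      funext x
      simp [mellinLogIntegrand, expMellinConvPow, ← Complex.exp_add, sub_eq_add_neg]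
    have hcont : Continuous fun x : ℝ => ((Real.exp (x - Real.exp x) : ℝ) : ℂ) := by fun_prop
    rw [h]
    refine ⟨.ofNormedAddCommGroup _ hcont 1 fun x => ?_, rfl⟩
    rw [Complex.norm_real, Real.norm_of_nonneg (Real.exp_nonneg _), Real.exp_le_one_iff]
    linarith [Real.add_one_le_exp x]
  | succ n ih =>
    obtain ⟨G, hG⟩ := ih
    simp only [expMellinConvPow, ofReal_mellinConv, mellinLogIntegrand_mellinConv, ← hG]
    exact exists_boundedContinuousFunction_eq_convolution _ integrable_mellinLogIntegrand_exp_neg G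

lemma continuousOn_expMellinConvPow (n : ℕ) : ContinuousOn (expMellinConvPow n) (Ioi 0) := by
  obtain ⟨G, hG⟩ := exists_boundedContinuousFunction_eq_mellinLogIntegrand n
  have h : ∀ y ∈ Ioi (0 : ℝ), expMellinConvPow n y = (G (Real.log y)).re / y := fun y hy => by
    rw [hG, mellinLogIntegrand, one_mul, ← Complex.ofReal_exp, Real.exp_log hy,
      ← Complex.ofReal_mul, Complex.ofReal_re, mul_div_cancel_left₀ _ hy.ne']
  refine ContinuousOn.congr ?_ h
  refine ContinuousOn.div ?_ continuousOn_id fun y hy => hy.ne'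
  exact (Complex.continuous_re.comp G.continuous).comp_continuousOn
    (Real.continuousOn_log.mono fun y hy => hy.ne')

lemma mellinConvExistsAt_exp_neg_expMellinConvPow (n : ℕ) {y : ℝ} (hy : 0 < y) :
    MellinConvExistsAt (fun u => Real.exp (-u)) (expMellinConvPow n) y := by
  obtain ⟨G, hG⟩ := exists_boundedContinuousFunction_eq_mellinLogIntegrand n
  have h := convolutionExists_boundedContinuousFunction (ContinuousLinearMap.mul ℂ ℂ)
    integrable_mellinLogIntegrand_exp_neg G (Real.log y)
  rw [hG] at h
  simp only [ConvolutionExistsAt, ContinuousLinearMap.mul_apply',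
    mellinLogIntegrand_mul_mellinLogIntegrand_sub, Real.exp_log hy] at h
  rw [MellinConvExistsAt, integrableOn_Ioi_inv_smul_iff_comp_exp]
  refine ((h.const_mul (Complex.exp (1 * (Real.log y : ℂ)))⁻¹).re).congr (ae_of_all _ fun x => ?_)
  beta_reduce
  rw [inv_mul_cancel_left₀ (Complex.exp_ne_zero _), ← Complex.ofReal_mul]
  rfl

end ExpMellinConvPow

section Gamma

lemma norm_Gamma_le_Gamma_re {s : ℂ} (hs : 0 < s.re) : ‖Complex.Gamma s‖ ≤ Real.Gamma s.re := by
  rw [Complex.Gamma_eq_integral hs, Real.Gamma_eq_integral hs]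
  refine (norm_integral_le_integral_norm _).trans_eq ?_
  refine setIntegral_congr_fun measurableSet_Ioi fun u hu => ?_
  simp only [norm_mul, Complex.norm_real, Real.norm_eq_abs, abs_of_pos (Real.exp_pos _),
    Complex.norm_cpow_eq_rpow_re_of_pos hu, Complex.sub_re, Complex.one_re]

lemma norm_Gamma_le_div_norm_sq {s : ℂ} (hs : 0 < s.re) :
    ‖Complex.Gamma s‖ ≤ Real.Gamma (s.re + 2) / ‖s‖ ^ 2 := by
  have hs₀ : s ≠ 0 := fun h => by simp [h] at hs
  have hs₁ : s + 1 ≠ 0 := fun h => by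
    have := congrArg Complex.re h
    simp only [Complex.add_re, Complex.one_re, Complex.zero_re] at this
    linarith
  have hΓ : ‖s + 1‖ * ‖s‖ * ‖Complex.Gamma s‖ ≤ Real.Gamma (s.re + 2) := by
    rw [← norm_mul, ← norm_mul, mul_assoc, ← Complex.Gamma_add_one s hs₀,
      ← Complex.Gamma_add_one (s + 1) hs₁, add_assoc, one_add_one_eq_two]
    simpa using norm_Gamma_le_Gamma_re (s := s + 2) (by simpa using by linarith)
  have hnorm : ‖s‖ ≤ ‖s + 1‖ := by
    rw [← sq_le_sq₀ (norm_nonneg _) (norm_nonneg _), Complex.sq_norm, Complex.sq_norm,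
      Complex.normSq_apply, Complex.normSq_apply]
    simp only [Complex.add_re, Complex.one_re, Complex.add_im, Complex.one_im]
    nlinarith
  rw [le_div_iff₀ (by positivity), sq, mul_comm]
  exact le_trans (by gcongr) hΓ

lemma continuous_Gamma_vertical {c : ℝ} (hc : 0 < c) :
    Continuous fun t : ℝ => Complex.Gamma (c + t * Complex.I) := by
  refine continuous_iff_continuousAt.2 fun t => ContinuousAt.comp
    (f := fun t : ℝ => (c : ℂ) + t * Complex.I)
    (Complex.differentiableAt_Gamma _ fun n hn => ?_).continuousAt (by fun_prop)
  have hre : c = -n := by simpa using congrArg Complex.re hn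
  linarith [(Nat.cast_nonneg n : (0 : ℝ) ≤ n)]

lemma integrable_inv_sq_add_sq {c : ℝ} (hc : c ≠ 0) :
    Integrable fun t : ℝ => (c ^ 2 + t ^ 2)⁻¹ := by
  refine ((integrable_inv_one_add_sq.comp_div hc).const_mul (c ^ 2)⁻¹).congr
    (ae_of_all _ fun t => ?_)
  field_simp

lemma verticalIntegrable_Gamma {c : ℝ} (hc : 0 < c) :
    Complex.VerticalIntegrable Complex.Gamma c := by
  refine Integrable.mono' ((integrable_inv_sq_add_sq hc.ne').const_mul (Real.Gamma (c + 2)))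
    (continuous_Gamma_vertical hc).aestronglyMeasurable (ae_of_all _ fun t => ?_)
  have h := norm_Gamma_le_div_norm_sq (s := c + t * Complex.I) (by simpa using hc)
  rwa [Complex.sq_norm, Complex.normSq_add_mul_I, div_eq_mul_inv,
    show ((c : ℂ) + t * Complex.I).re = c by simp] at h

lemma verticalIntegrable_Gamma_pow {n : ℕ} (hn : n ≠ 0) {c : ℝ} (hc : 0 < c) :
    Complex.VerticalIntegrable (fun s => Complex.Gamma s ^ n) c := by
  obtain ⟨n, rfl⟩ := Nat.exists_eq_succ_of_ne_zero hn
  simp only [Nat.succ_eq_add_one, pow_succ]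
  refine Integrable.bdd_mul (c := Real.Gamma c ^ n) (verticalIntegrable_Gamma hc)
    ((continuous_Gamma_vertical hc).pow n).aestronglyMeasurable (ae_of_all _ fun t => ?_)
  rw [norm_pow]
  gcongr
  simpa using norm_Gamma_le_Gamma_re (s := c + t * Complex.I) (by simpa using hc)

end Gamma

/-- The Meijer G-function `G_{0,d}^{d,0}(y | 0, …, 0)`, integrated along `Re s = c`. -/
noncomputable def meijerGZero (d : ℕ) (c y : ℝ) : ℂ :=
  meijerG d 0 (fun j : Fin 0 => j.elim0) (fun _ : Fin d => 0) c y

section MeijerG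

variable {c y : ℝ}

lemma meijerKernel_zero (d : ℕ) (s : ℂ) :
    meijerKernel d 0 (fun j : Fin 0 => j.elim0) (fun _ : Fin d => 0) s = Complex.Gamma s ^ d := by
  simp [meijerKernel]

lemma verticalIntegrable_cpow_neg_mul_meijerKernel_zero {d : ℕ} (hd : d ≠ 0) (hc : 0 < c)
    (hy : 0 < y) :
    Complex.VerticalIntegrable (fun s => (y : ℂ) ^ (-s) *
      meijerKernel d 0 (fun j : Fin 0 => j.elim0) (fun _ : Fin d => 0) s) c := by
  simp only [meijerKernel_zero]
  have hcont : Continuous fun t : ℝ => (y : ℂ) ^ (-(c + t * Complex.I)) :=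
    Continuous.const_cpow (by fun_prop) (Or.inl (by exact_mod_cast hy.ne'))
  refine Integrable.bdd_mul (c := y ^ (-c)) (verticalIntegrable_Gamma_pow hd hc)
    hcont.aestronglyMeasurable (ae_of_all _ fun t => ?_)
  simp [Complex.norm_cpow_eq_rpow_re_of_pos hy]

lemma meijerGZero_eq_expMellinConvPow (n : ℕ) (hc : 0 < c) (hy : 0 < y) :
    meijerGZero (n + 1) c y = expMellinConvPow n y := by
  have hmellin := fun t : ℝ =>
    hasMellin_expMellinConvPow n (s := c + t * Complex.I) (by simpa using hc)
  have hconv := (hasMellin_expMellinConvPow n (s := c) (by simpa using hc)).1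
  have hvert : Complex.VerticalIntegrable (mellin fun y => (expMellinConvPow n y : ℂ)) c := by
    simpa only [Complex.VerticalIntegrable, (hmellin _).2] using
      verticalIntegrable_Gamma_pow n.succ_ne_zero hc
  have hcont : ContinuousAt (fun y => (expMellinConvPow n y : ℂ)) y :=
    Complex.continuous_ofReal.continuousAt.comp
      ((continuousOn_expMellinConvPow n).continuousAt (Ioi_mem_nhds hy))
  rw [← mellinInv_mellin_eq c _ hy hconv hvert hcont]
  simp only [meijerGZero, meijerG, mellinInv, meijerKernel_zero, (hmellin _).2]

lemma meijerGZero_im {d : ℕ} (hd : d ≠ 0) (hc : 0 < c) (hy : 0 < y) :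
    (meijerGZero d c y).im = 0 := by
  obtain ⟨n, rfl⟩ := Nat.exists_eq_succ_of_ne_zero hd
  rw [meijerGZero_eq_expMellinConvPow n hc hy, Complex.ofReal_im]

lemma meijerGZero_re_nonneg {d : ℕ} (hd : d ≠ 0) (hc : 0 < c) (hy : 0 < y) :
    0 ≤ (meijerGZero d c y).re := by
  obtain ⟨n, rfl⟩ := Nat.exists_eq_succ_of_ne_zero hd
  rw [meijerGZero_eq_expMellinConvPow n hc hy, Complex.ofReal_re]
  exact expMellinConvPow_nonneg n hy

end MeijerG

section ProductDensity

lemma lintegral_comp_mul_left {a : ℝ} (ha : a ≠ 0) {h : ℝ → ℝ≥0∞} (hh : Measurable h) :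
    ∫⁻ x, h (a * x) = ‖a⁻¹‖ₑ * ∫⁻ x, h x := by
  rw [← lintegral_map hh (measurable_const_mul a), Real.map_volume_mul_left ha,
    lintegral_smul_measure, smul_eq_mul, Real.enorm_eq_ofReal_abs]

lemma mconv_withDensity_volume {f g : ℝ → ℝ≥0∞} (hf : Measurable f) (hg : Measurable g) :
    (volume.withDensity f).mconv (volume.withDensity g) =
      volume.withDensity fun t => ∫⁻ z, ‖z⁻¹‖ₑ * (f z * g (t / z)) := by
  refine Measure.ext_of_lintegral _ fun φ hφ => ?_
  have hinner : ∀ z ≠ 0, f z * ∫⁻ y, g y * φ (z * y) =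
      ∫⁻ t, ‖z⁻¹‖ₑ * (f z * g (t / z)) * φ t := fun z hz => by
    have h := lintegral_comp_mul_left hz (h := fun t => g (t / z) * φ t) (by fun_prop)
    simp only [mul_div_cancel_left₀ _ hz] at h
    rw [h, ← lintegral_const_mul _ (by fun_prop), ← lintegral_const_mul _ (by fun_prop)]
    simp only [mul_assoc, mul_left_comm (f z)]
  calc ∫⁻ t, φ t ∂((volume.withDensity f).mconv (volume.withDensity g))
      = ∫⁻ z, f z * ∫⁻ y, g y * φ (z * y) := by
        rw [Measure.lintegral_mconv hφ, lintegral_withDensity_eq_lintegral_mul _ hf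
          (Measurable.lintegral_prod_right' (f := fun p : ℝ × ℝ => φ (p.1 * p.2)) (by fun_prop))]
        refine lintegral_congr fun z => ?_
        rw [Pi.mul_apply, lintegral_withDensity_eq_lintegral_mul _ hg (by fun_prop)]
        rfl
    _ = ∫⁻ z, ∫⁻ t, ‖z⁻¹‖ₑ * (f z * g (t / z)) * φ t :=
        lintegral_congr_ae ((Measure.ae_ne volume 0).mono hinner)
    _ = ∫⁻ t, ∫⁻ z, ‖z⁻¹‖ₑ * (f z * g (t / z)) * φ t := lintegral_lintegral_swap (by fun_prop)
    _ = ∫⁻ t, φ t ∂(volume.withDensity fun t => ∫⁻ z, ‖z⁻¹‖ₑ * (f z * g (t / z))) := by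
        rw [lintegral_withDensity_eq_lintegral_mul _
          (Measurable.lintegral_prod_right'
            (f := fun p : ℝ × ℝ => ‖p.2⁻¹‖ₑ * (f p.2 * g (p.1 / p.2))) (by fun_prop)) hφ]
        exact lintegral_congr fun t => lintegral_mul_const _ (by fun_prop)

lemma lintegral_eq_two_mul_setLIntegral_Ioi {h : ℝ → ℝ≥0∞} (hh : ∀ x, h (-x) = h x) :
    ∫⁻ x, h x = 2 * ∫⁻ x in Ioi (0 : ℝ), h x := by
  have hneg : ∫⁻ x in Iio (0 : ℝ), h x = ∫⁻ x in Ioi (0 : ℝ), h x := by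
    rw [← neg_zero, ← image_neg_Ioi, lintegral_image_eq_lintegral_abs_deriv_mul measurableSet_Ioi
      (fun x _ => (hasDerivAt_neg x).hasDerivWithinAt) neg_injective.injOn]
    simp [hh]
  rw [← lintegral_add_compl h measurableSet_Ioi, compl_Ioi,
    setLIntegral_congr Iio_ae_eq_Iic.symm, hneg, two_mul]

lemma image_sq_Ioi_zero : (fun z : ℝ => z ^ 2) '' Ioi 0 = Ioi 0 := by
  ext u
  exact ⟨by rintro ⟨z, hz, rfl⟩; exact pow_pos (mem_Ioi.1 hz) 2,
    fun hu => ⟨√u, Real.sqrt_pos.2 hu, Real.sq_sqrt (le_of_lt hu)⟩⟩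

lemma lintegral_enorm_inv_mul_comp_sq (h : ℝ → ℝ≥0∞) :
    ∫⁻ z : ℝ, ‖z⁻¹‖ₑ * h (z ^ 2) = ∫⁻ u in Ioi (0 : ℝ), ‖u⁻¹‖ₑ * h u := by
  have hinj : InjOn (fun z : ℝ => z ^ 2) (Ioi 0) := fun a ha b hb hab =>
    (pow_left_inj₀ (le_of_lt ha) (le_of_lt hb) two_ne_zero).1 hab
  have hsubst := lintegral_image_eq_lintegral_abs_deriv_mul measurableSet_Ioi
    (fun z _ => (hasDerivAt_pow 2 z).hasDerivWithinAt) hinj fun u => ‖u⁻¹‖ₑ * h u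
  rw [image_sq_Ioi_zero] at hsubst
  rw [lintegral_eq_two_mul_setLIntegral_Ioi (by simp), hsubst,
    ← lintegral_const_mul' _ _ ENNReal.ofNat_ne_top]
  refine setLIntegral_congr_fun measurableSet_Ioi fun z hz => ?_
  have hz : 0 < z := hz
  have hjac : 2 * ‖z⁻¹‖ₑ = ENNReal.ofReal |2 * z| * ‖(z ^ 2)⁻¹‖ₑ := by
    rw [← Real.enorm_eq_ofReal_abs, ← enorm_mul, show 2 * z * (z ^ 2)⁻¹ = 2 * z⁻¹ by field_simp,
      enorm_mul, Real.enorm_of_nonneg zero_le_two, ENNReal.ofReal_ofNat]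
  simp only [← mul_assoc, hjac, Nat.cast_ofNat, Nat.add_one_sub_one, pow_one]

lemma mconv_withDensity_comp_sq {f g : ℝ → ℝ} (hf : Measurable f) (hg : Measurable g)
    (hf₀ : ∀ u, 0 < u → 0 ≤ f u) (hg₀ : ∀ u, 0 < u → 0 ≤ g u)
    (hfg : ∀ y, 0 < y → MellinConvExistsAt f g y) :
    (volume.withDensity fun x => ENNReal.ofReal (f (x ^ 2))).mconv
        (volume.withDensity fun x => ENNReal.ofReal (g (x ^ 2))) =
      volume.withDensity fun x => ENNReal.ofReal (mellinConv f g (x ^ 2)) := by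
  rw [mconv_withDensity_volume (by fun_prop) (by fun_prop)]
  refine withDensity_congr_ae ((Measure.ae_ne volume 0).mono fun t ht => ?_)
  have ht : 0 < t ^ 2 := by positivity
  have hint : ∀ᵐ u ∂volume.restrict (Ioi (0 : ℝ)), 0 ≤ u⁻¹ • (f u * g (t ^ 2 / u)) :=
    (ae_restrict_mem measurableSet_Ioi).mono fun u hu => smul_nonneg (inv_nonneg.2 (le_of_lt hu))
      (mul_nonneg (hf₀ u hu) (hg₀ _ (div_pos ht hu)))
  simp only [mellinConv]
  rw [ofReal_integral_eq_lintegral_ofReal (hfg _ ht) hint]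
  simp only [div_pow]
  rw [lintegral_enorm_inv_mul_comp_sq
    fun u => ENNReal.ofReal (f u) * ENNReal.ofReal (g (t ^ 2 / u))]
  refine setLIntegral_congr_fun measurableSet_Ioi fun u hu => ?_
  have hu : 0 < u := hu
  rw [smul_eq_mul, ENNReal.ofReal_mul (by positivity), ENNReal.ofReal_mul (hf₀ u hu),
    Real.enorm_of_nonneg (by positivity)]

lemma gaussianReal_toNNReal_eq_withDensity {v : ℝ} (hv : 0 < v) :
    gaussianReal 0 v.toNNReal = volume.withDensity fun x =>
      ENNReal.ofReal ((√(2 * Real.pi * v))⁻¹ * Real.exp (-((2 * v)⁻¹ * x ^ 2))) := by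
  rw [gaussianReal_of_var_ne_zero _ (by simpa using hv)]
  congr 1
  funext x
  simp [gaussianPDF, gaussianPDFReal, hv.le, div_eq_inv_mul]

end ProductDensity

section ProductGaussian

@[to_additive]
lemma map_prod_pi_succ {M : Type*} [CommMonoid M] [MeasurableSpace M] [MeasurableMul₂ M] {n : ℕ}
    (μ : Fin (n + 1) → Measure M) [∀ i, SigmaFinite (μ i)] :
    (Measure.pi μ).map (fun x => ∏ i, x i) =
      (μ 0).mconv ((Measure.pi fun i : Fin n => μ i.succ).map fun x => ∏ i, x i) := by
  have hprod : Measurable fun x : Fin n → M => ∏ i, x i :=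
    Finset.measurable_prod _ fun i _ => measurable_pi_apply i
  have hsplit : (fun x : Fin (n + 1) → M => ∏ i, x i) =
      (fun q : M × M => q.1 * q.2) ∘ Prod.map id (fun x : Fin n → M => ∏ i, x i) ∘
        MeasurableEquiv.piFinSuccAbove (fun _ => M) 0 := by
    funext x
    simp [Fin.prod_univ_succ, Fin.tail]
  rw [hsplit, ← Measure.map_map measurable_mul (by fun_prop),
    ← Measure.map_map (measurable_id.prodMap hprod) (by fun_prop),
    (measurePreserving_piFinSuccAbove μ 0).map_eq, ← Measure.map_prod_map _ _ measurable_id hprod,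
    Measure.map_id]
  simp only [Measure.mconv, Fin.zero_succAbove]

lemma map_prod_pi_gaussianReal {n : ℕ} {v : Fin (n + 1) → ℝ} (hv : ∀ i, 0 < v i) :
    (Measure.pi fun i => gaussianReal 0 (v i).toNNReal).map (fun x => ∏ i, x i) =
      volume.withDensity fun x => ENNReal.ofReal
        ((∏ i, (√(2 * Real.pi * v i))⁻¹) *
          expMellinConvPow n ((∏ i, (2 * v i)⁻¹) * x ^ 2)) := by
  induction n with
  | zero =>
    simpa [expMellinConvPow] using
      (measurePreserving_eval (fun i => gaussianReal 0 (v i).toNNReal) 0).map_eq.trans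
        (gaussianReal_toNNReal_eq_withDensity (hv 0))
  | succ n ih =>
    have hb : 0 < ∏ i : Fin (n + 1), (2 * v i.succ)⁻¹ :=
      Finset.prod_pos fun i _ => inv_pos.2 (mul_pos two_pos (hv i.succ))
    have ha : 0 < (2 * v 0)⁻¹ := inv_pos.2 (mul_pos two_pos (hv 0))
    have hF := measurable_expMellinConvPow n
    rw [map_prod_pi_succ, ih fun i => hv i.succ, gaussianReal_toNNReal_eq_withDensity (hv 0),
      mconv_withDensity_comp_sq
        (f := fun u => (√(2 * Real.pi * v 0))⁻¹ * Real.exp (-((2 * v 0)⁻¹ * u)))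
        (g := fun u => (∏ i : Fin (n + 1), (√(2 * Real.pi * v i.succ))⁻¹) *
          expMellinConvPow n ((∏ i : Fin (n + 1), (2 * v i.succ)⁻¹) * u))]
    · simp only [mellinConv_const_mul, Fin.prod_univ_succ (n := n + 1)]
      simp only [mellinConv_comp_mul_left ha (f := fun u => Real.exp (-u))]
      rfl
    · fun_prop
    · fun_prop
    · exact fun u _ => by positivity
    · exact fun u hu => mul_nonneg (by positivity) (expMellinConvPow_nonneg n (mul_pos hb hu))
    · exact fun y hy => ((mellinConvExistsAt_exp_neg_expMellinConvPow n
        (mul_pos (mul_pos ha hb) hy)).comp_mul_left ha).const_mul _ _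

/-- The function `x ↦ (2π)^(-d/2) ∏_h v_h^(-1/2) * G_{0,d}^{d,0}(x² ∏_h (2 v_h)⁻¹ | 0, …, 0)`, the
density of a product of `d` independent centred Gaussian variables with variances `v_1, …, v_d`. The
Meijer G-function is integrated along `Re s = c`. -/
noncomputable def productGaussianDensity {d : ℕ} (c : ℝ) (v : Fin d → ℝ) (x : ℝ) : ℝ :=
  (2 * Real.pi) ^ (-(d / 2) : ℝ) * (∏ h, v h ^ (-(1 / 2) : ℝ)) *
    (meijerGZero d c (x ^ 2 * ∏ h, (2 * v h)⁻¹)).re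

lemma prod_inv_sqrt_two_pi_mul {d : ℕ} {v : Fin d → ℝ} (hv : ∀ h, 0 < v h) :
    ∏ h, (√(2 * Real.pi * v h))⁻¹ =
      (2 * Real.pi) ^ (-(d / 2) : ℝ) * ∏ h, v h ^ (-(1 / 2) : ℝ) := by
  have hsqrt : ∀ h, (√(2 * Real.pi * v h))⁻¹ =
      (2 * Real.pi) ^ (-(1 / 2) : ℝ) * v h ^ (-(1 / 2) : ℝ) := fun h => by
    rw [Real.sqrt_eq_rpow, ← Real.rpow_neg (by have := hv h; positivity),
      Real.mul_rpow (by positivity) (hv h).le]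
  simp only [hsqrt, Finset.prod_mul_distrib, Finset.prod_const, Finset.card_univ,
    Fintype.card_fin, ← Real.rpow_mul_natCast Real.two_pi_pos.le]
  ring_nf

variable {d : ℕ} {c : ℝ} {v : Fin d → ℝ}

lemma productGaussianDensity_eq {n : ℕ} {v : Fin (n + 1) → ℝ} (hc : 0 < c) (hv : ∀ h, 0 < v h)
    {x : ℝ} (hx : x ≠ 0) :
    productGaussianDensity c v x = (∏ h, (√(2 * Real.pi * v h))⁻¹) *
      expMellinConvPow n ((∏ h, (2 * v h)⁻¹) * x ^ 2) := by
  have hy : 0 < x ^ 2 * ∏ h, (2 * v h)⁻¹ :=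
    mul_pos (by positivity) (Finset.prod_pos fun h _ => inv_pos.2 (mul_pos two_pos (hv h)))
  rw [productGaussianDensity, meijerGZero_eq_expMellinConvPow n hc hy, Complex.ofReal_re,
    prod_inv_sqrt_two_pi_mul hv, mul_comm (x ^ 2)]

lemma aemeasurable_productGaussianDensity (hd : d ≠ 0) (hc : 0 < c) (hv : ∀ h, 0 < v h) :
    AEMeasurable (productGaussianDensity c v) := by
  obtain ⟨n, rfl⟩ := Nat.exists_eq_succ_of_ne_zero hd
  have hF := measurable_expMellinConvPow n
  exact AEMeasurable.congr (by fun_prop) ((Measure.ae_ne volume 0).mono fun x hx =>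
    (productGaussianDensity_eq hc hv hx).symm)

lemma map_prod_pi_gaussianReal_eq_withDensity (hd : d ≠ 0) (hc : 0 < c) (hv : ∀ h, 0 < v h) :
    (Measure.pi fun h => gaussianReal 0 (v h).toNNReal).map (fun x => ∏ h, x h) =
      volume.withDensity fun x => ENNReal.ofReal (productGaussianDensity c v x) := by
  obtain ⟨n, rfl⟩ := Nat.exists_eq_succ_of_ne_zero hd
  rw [map_prod_pi_gaussianReal hv]
  exact withDensity_congr_ae ((Measure.ae_ne volume 0).mono fun x hx =>
    congrArg ENNReal.ofReal (productGaussianDensity_eq hc hv hx).symm)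

lemma isProbabilityMeasure_productGaussianDensity (hd : d ≠ 0) (hc : 0 < c)
    (hv : ∀ h, 0 < v h) : IsProbabilityMeasure
      (volume.withDensity fun x => ENNReal.ofReal (productGaussianDensity c v x)) := by
  rw [← map_prod_pi_gaussianReal_eq_withDensity hd hc hv]
  exact Measure.isProbabilityMeasure_map (by fun_prop)

end ProductGaussian

section ConvList

lemma map_sum_pi_eq_measureConvList {n : ℕ} (μ : Fin n → Measure ℝ) [∀ i, SigmaFinite (μ i)] :
    (Measure.pi μ).map (fun x => ∑ i, x i) = measureConvList (List.ofFn μ) := by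
  induction n with
  | zero =>
    rw [Measure.pi_of_empty _ finZeroElim, Measure.map_dirac' (by fun_prop)]
    simp [measureConvList]
  | succ n ih =>
    rw [map_sum_pi_succ, ih, List.ofFn_succ]
    rfl

lemma aemeasurable_densityConvList {L : List (ℝ → ℝ≥0∞)} (hL : ∀ f ∈ L, AEMeasurable f) :
    AEMeasurable (densityConvList L) := by
  induction L with
  | nil => exact aemeasurable_const
  | cons f L ih =>
    rw [List.forall_mem_cons] at hL
    cases L with
    | nil => exact hL.1
    | cons g L => exact aemeasurable_lconvolution hL.1 (ih hL.2)

lemma measureConvList_map_withDensity {L : List (ℝ → ℝ≥0∞)} (hL : ∀ f ∈ L, AEMeasurable f)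
    (hne : L ≠ []) :
    measureConvList (L.map volume.withDensity) = volume.withDensity (densityConvList L) := by
  induction L with
  | nil => exact absurd rfl hne
  | cons f L ih =>
    rw [List.forall_mem_cons] at hL
    cases L with
    | nil => simp [measureConvList, densityConvList]
    | cons g L =>
      rw [List.map_cons, measureConvList, List.foldr_cons, ← measureConvList,
        ih hL.2 (List.cons_ne_nil g L),
        conv_withDensity_eq_mlconvolution₀ hL.1 (aemeasurable_densityConvList hL.2)]
      rfl

lemma measureConvList_ofFn_withDensity {n : ℕ} (hn : 0 < n) {f : Fin n → ℝ → ℝ≥0∞}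
    (hf : ∀ i, AEMeasurable (f i)) :
    measureConvList (List.ofFn fun i => volume.withDensity (f i)) =
      volume.withDensity (densityConvList (List.ofFn f)) := by
  rw [← measureConvList_map_withDensity (by simpa [List.mem_ofFn'] using hf)
    (by simpa using hn.ne'), List.map_ofFn]
  rfl

end ConvList

section PiPi

variable {ι κ : Type*} [Fintype ι] [Fintype κ]

lemma map_swap_pi_pi {X : Type*} [MeasurableSpace X] (μ : ι → κ → Measure X)
    [∀ i j, IsProbabilityMeasure (μ i j)] :
    (Measure.pi fun i => Measure.pi fun j => μ i j).map (fun x j i => x i j) =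
      Measure.pi fun j => Measure.pi fun i => μ i j := by
  have hswap := Measure.map_infinitePi_infinitePi_of_inj (P := fun p : ι × κ => μ p.1 p.2)
    (Prod.swap_injective (α := κ))
  simp only [Prod.fst_swap, Prod.snd_swap] at hswap
  simp only [← Measure.infinitePi_eq_pi]
  rw [← Measure.infinitePi_map_curry fun j i => μ i j,
    ← hswap, ← Measure.infinitePi_map_curry_symm, Measure.map_map (by fun_prop) (by fun_prop),
    Measure.map_map (by fun_prop) (by fun_prop)]
  rfl

lemma map_prod_comp_pi_pi {M : Type*} [CommMonoid M] [MeasurableSpace M] [MeasurableMul₂ M]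
    {E : ι → Type*} [∀ i, MeasurableSpace (E i)] (μ : ∀ i, κ → Measure (E i))
    [∀ i j, IsProbabilityMeasure (μ i j)] {f : ∀ i, E i → M} (hf : ∀ i, Measurable (f i)) :
    (Measure.pi fun i => Measure.pi fun j => μ i j).map (fun β j => ∏ i, f i (β i j)) =
      Measure.pi fun j => (Measure.pi fun i => (μ i j).map (f i)).map fun x => ∏ i, x i := by
  have hprob : ∀ i j, IsProbabilityMeasure ((μ i j).map (f i)) := fun i j =>
    Measure.isProbabilityMeasure_map (hf i).aemeasurable
  have hprod : Measurable fun x : ι → M => ∏ i, x i :=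
    Finset.measurable_prod _ fun i _ => measurable_pi_apply i
  have hcoord : (Measure.pi fun i => Measure.pi fun j => μ i j).map (fun β i j => f i (β i j)) =
      Measure.pi fun i => Measure.pi fun j => (μ i j).map (f i) := by
    rw [Measure.pi_map_pi (f := fun i (x : κ → E i) j => f i (x j)) fun i =>
      (measurable_pi_lambda _ fun j => (hf i).comp (measurable_pi_apply j)).aemeasurable]
    simp only [Measure.pi_map_pi fun _ => (hf _).aemeasurable]
  rw [← Measure.pi_map_pi (f := fun _ (x : ι → M) => ∏ i, x i) fun j => hprod.aemeasurable,
    ← map_swap_pi_pi fun i j => (μ i j).map (f i), ← hcoord,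
    Measure.map_map (by fun_prop) (by fun_prop), Measure.map_map (by fun_prop) (by fun_prop)]
  rfl

lemma map_prod_eval_pi_pi_multivariateGaussian {R d : ℕ} (hd : d ≠ 0) {I : Fin d → ℕ} {c : ℝ}
    (hc : 0 < c) {S : (h : Fin d) → Fin R → Matrix (Fin (I h)) (Fin (I h)) ℝ}
    (m : (h : Fin d) → Fin (I h))
    (hS : ∀ h r, (S h r).PosSemidef ∧ 0 < S h r (m h) (m h)) :
    (Measure.pi fun h => Measure.pi fun r => multivariateGaussian 0 (S h r)).map
        (fun β r => ∏ h, β h r (m h)) =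
      Measure.pi fun r => volume.withDensity fun x =>
        ENNReal.ofReal (productGaussianDensity c (fun h => S h r (m h) (m h)) x) := by
  rw [map_prod_comp_pi_pi (fun h r => multivariateGaussian 0 (S h r))
    (f := fun h (x : EuclideanSpace ℝ (Fin (I h))) => x (m h)) fun h => by fun_prop]
  refine congrArg Measure.pi (funext fun r => ?_)
  simp only [(measurePreserving_eval_multivariateGaussian (hS _ r).1).map_eq]
  exact map_prod_pi_gaussianReal_eq_withDensity hd hc fun h => (hS h r).2

end PiPi

section CondDistrib

variable {Ω Θ E : Type*} [MeasurableSpace Ω] [MeasurableSpace Θ] [MeasurableSpace E]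
  [StandardBorelSpace E] [Nonempty E] {P : Measure Ω} [IsFiniteMeasure P] {θ : Ω → Θ} {X : Ω → E}

lemma ae_of_ae_condDistrib (hθ : AEMeasurable θ P) (hX : AEMeasurable X P) {p : E → Prop}
    (hp : MeasurableSet {x | p x})
    (h : ∀ᵐ t ∂P.map θ, ∀ᵐ x ∂condDistrib X θ P t, p x) : ∀ᵐ ω ∂P, p (X ω) := by
  have hcompProd : ∀ᵐ z ∂P.map fun ω => (θ ω, X ω), p z.2 := by
    rw [← compProd_map_condDistrib hX]
    exact (Measure.ae_compProd_iff (measurable_snd hp)).2 h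
  exact ae_of_ae_map (hθ.prodMk hX) hcompProd

lemma ae_condDistrib_of_map_eq_pi (hX : AEMeasurable X P) {n : ℕ} {f : E → Fin n → ℝ}
    (hf : Measurable f) :
    ∀ᵐ t ∂P.map θ, ∀ (μ : Fin n → Measure ℝ) [∀ r, IsProbabilityMeasure (μ r)],
      (condDistrib X θ P t).map f = Measure.pi μ →
        (∀ r, condDistrib (fun ω => f (X ω) r) θ P t = μ r) ∧
        condDistrib (fun ω => ∑ r, f (X ω) r) θ P t = measureConvList (List.ofFn μ) := by
  have hcoord : ∀ᵐ t ∂P.map θ, ∀ r, condDistrib ((fun x => f x r) ∘ X) θ P t = _ :=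
    ae_all_iff.2 fun r => condDistrib_comp θ hX (hf.eval (a := r))
  have hsum : condDistrib ((fun x => ∑ r, f x r) ∘ X) θ P =ᵐ[P.map θ] _ :=
    condDistrib_comp θ hX (by fun_prop)
  filter_upwards [hcoord, hsum] with t hcoord hsum μ _ hμ
  refine ⟨fun r => (hcoord r).trans ?_, hsum.trans ?_⟩
  · rw [Kernel.map_apply _ (by fun_prop), ← (measurePreserving_eval μ r).map_eq, ← hμ,
      Measure.map_map (by fun_prop) hf]
    rfl
  · rw [Kernel.map_apply _ (by fun_prop), ← map_sum_pi_eq_measureConvList, ← hμ,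
      Measure.map_map (by fun_prop) hf]
    rfl

end CondDistrib

section Positivity

lemma ae_pi_of_forall_ae {ι : Type*} [Fintype ι] {X : ι → Type*} [∀ i, MeasurableSpace (X i)]
    {μ : ∀ i, Measure (X i)} [∀ i, SigmaFinite (μ i)] {p : ∀ i, X i → Prop}
    (h : ∀ i, ∀ᵐ x ∂μ i, p i x) : ∀ᵐ x ∂Measure.pi μ, ∀ i, p i (x i) :=
  eventually_all.2 fun i => Measure.tendsto_eval_ae_ae.eventually (h i)

lemma ae_gammaMeasure_pos (a r : ℝ) : ∀ᵐ x ∂gammaMeasure a r, 0 < x := by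
  have h : gammaMeasure a r (Iic 0) = 0 := by
    rw [gammaMeasure, withDensity_apply _ measurableSet_Iic, ← setLIntegral_congr Iio_ae_eq_Iic]
    exact lintegral_gammaPDF_of_nonpos le_rfl
  rw [ae_iff]
  simpa only [not_lt] using! h

lemma ae_dirichletMeasure_pos {R : ℕ} {a : Fin R → ℝ} (ha : ∀ r, 0 < a r) :
    ∀ᵐ x ∂dirichletMeasure a, ∀ r, 0 < x r := by
  have := fun r => isProbabilityMeasure_gammaMeasure (ha r) one_pos
  refine ae_all_iff.2 fun r => ?_
  rw [dirichletMeasure, ae_map_iff (by fun_prop)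
    (measurableSet_lt measurable_const (measurable_pi_apply r))]
  filter_upwards [ae_pi_of_forall_ae fun r => ae_gammaMeasure_pos (a r) 1] with x hx
  exact div_pos (hx r) (Finset.sum_pos (fun s _ => hx s) ⟨r, Finset.mem_univ r⟩)

lemma posSemidef_smul_diagonal_and_pos {n : Type*} [DecidableEq n] {t : ℝ} (ht : 0 < t)
    {w : n → ℝ} (hw : ∀ i, 0 < w i) (i : n) :
    (t • Matrix.diagonal w).PosSemidef ∧ 0 < (t • Matrix.diagonal w) i i :=
  ⟨(Matrix.PosSemidef.diagonal fun j => (hw j).le).smul ht.le, by simp [ht, hw i]⟩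

namespace IsGlobalLocalPrior

variable {Ω : Type*} [MeasurableSpace Ω] {P : Measure Ω} [IsProbabilityMeasure P] {R : ℕ}
  {I : Fin 4 → ℕ} {α aτ bτ al bl : ℝ} {φ : Ω → Fin R → ℝ} {τ : Ω → ℝ}
  {lam : Ω → Fin 4 → Fin R → ℝ} {w : Ω → LocalScales R I} {β : Ω → ParafacMarginals R I}

lemma ae_lam_pos (hprior : IsGlobalLocalPrior P α aτ bτ al bl φ τ lam w β) (hal : 0 < al)
    (hbl : 0 < bl) : ∀ᵐ l ∂P.map lam, ∀ h r, 0 < l h r := by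
  have := isProbabilityMeasure_gammaMeasure hal hbl
  rw [hprior.law_lam]
  exact ae_pi_of_forall_ae (p := fun _ (x : Fin R → ℝ) => ∀ r, 0 < x r) fun _ =>
    ae_pi_of_forall_ae (p := fun _ (x : ℝ) => 0 < x) fun _ => ae_gammaMeasure_pos al bl

lemma ae_w_pos (hprior : IsGlobalLocalPrior P α aτ bτ al bl φ τ lam w β) (hal : 0 < al)
    (hbl : 0 < bl) (h : Fin 4) (r : Fin R) (p : Fin (I h)) : ∀ᵐ ω ∂P, 0 < w ω h r p := by
  refine ae_of_ae_condDistrib (p := fun x : LocalScales R I => 0 < x h r p)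
    hprior.measurable_lam.aemeasurable hprior.measurable_w.aemeasurable
    (measurableSet_lt measurable_const (by fun_prop)) ?_
  filter_upwards [hprior.law_w, hprior.ae_lam_pos hal hbl] with l hlaw hl
  have := fun h r => isProbabilityMeasure_expMeasure (div_pos (pow_pos (hl h r) 2) two_pos)
  have hexp : ∀ h r, ∀ᵐ x ∂expMeasure (l h r ^ 2 / 2), 0 < x := fun h r =>
    ae_gammaMeasure_pos 1 _
  rw [hlaw]
  have hpi := ae_pi_of_forall_ae (p := fun h (x : Fin R → Fin (I h) → ℝ) => ∀ r p, 0 < x r p)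
    fun h => ae_pi_of_forall_ae (p := fun _ (x : Fin (I h) → ℝ) => ∀ p, 0 < x p) fun r =>
      ae_pi_of_forall_ae (p := fun _ (x : ℝ) => 0 < x) fun _ => hexp h r
  exact hpi.mono fun x hx => hx h r p

lemma ae_pos (hprior : IsGlobalLocalPrior P α aτ bτ al bl φ τ lam w β) (hα : 0 < α)
    (hal : 0 < al) (hbl : 0 < bl) :
    ∀ᵐ θ ∂P.map fun ω => (τ ω, φ ω, w ω),
      0 < θ.1 ∧ (∀ r, 0 < θ.2.1 r) ∧ ∀ h r p, 0 < θ.2.2 h r p := by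
  have hτφw : AEMeasurable (fun ω => (τ ω, φ ω, w ω)) P := (hprior.measurable_τ.prodMk
    (hprior.measurable_φ.prodMk hprior.measurable_w)).aemeasurable
  have hτ : ∀ᵐ ω ∂P, 0 < τ ω := ae_of_ae_map hprior.measurable_τ.aemeasurable <| by
    rw [hprior.law_τ]
    exact ae_gammaMeasure_pos aτ bτ
  have hφ : ∀ᵐ ω ∂P, ∀ r, 0 < φ ω r := ae_of_ae_map hprior.measurable_φ.aemeasurable <| by
    rw [hprior.law_φ]
    exact ae_dirichletMeasure_pos fun _ => hα
  simp only [eventually_and, ae_all_iff]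
  refine ⟨?_, fun r => ?_, fun h r p => ?_⟩ <;>
    rw [ae_map_iff hτφw (measurableSet_lt measurable_const (by fun_prop))]
  exacts [hτ, ae_all_iff.1 hφ r, hprior.ae_w_pos hal hbl h r p]

lemma ae_posSemidef_covariance (hprior : IsGlobalLocalPrior P α aτ bτ al bl φ τ lam w β)
    (hα : 0 < α) (hal : 0 < al) (hbl : 0 < bl) (m : (h : Fin 4) → Fin (I h)) :
    ∀ᵐ θ ∂P.map fun ω => (τ ω, φ ω, w ω), ∀ h r,
      ((θ.1 * θ.2.1 r) • Matrix.diagonal (θ.2.2 h r)).PosSemidef ∧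
        0 < ((θ.1 * θ.2.1 r) • Matrix.diagonal (θ.2.2 h r)) (m h) (m h) :=
  (hprior.ae_pos hα hal hbl).mono fun _ ⟨hτ, hφ, hw⟩ h r =>
    posSemidef_smul_diagonal_and_pos (mul_pos hτ (hφ r)) (hw h r) (m h)

end IsGlobalLocalPrior

end Positivity

theorem lemma2_general {Ω Θ : Type*} [MeasurableSpace Ω] [MeasurableSpace Θ] {P : Measure Ω}
    [IsFiniteMeasure P] {R d : ℕ} (hR : 0 < R) (hd : d ≠ 0) {I : Fin d → ℕ} {θ : Ω → Θ}
    {β : Ω → (h : Fin d) → Fin R → EuclideanSpace ℝ (Fin (I h))} (hβ : AEMeasurable β P)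
    {S : Θ → (h : Fin d) → Fin R → Matrix (Fin (I h)) (Fin (I h)) ℝ}
    (law_β : ∀ᵐ t ∂P.map θ, condDistrib β θ P t =
      Measure.pi fun h => Measure.pi fun r => multivariateGaussian 0 (S t h r))
    (m : (h : Fin d) → Fin (I h))
    (hS : ∀ᵐ t ∂P.map θ, ∀ h r, (S t h r).PosSemidef ∧ 0 < S t h r (m h) (m h))
    {c : ℝ} (hc : 0 < c) :
    (∀ y : ℝ, 0 < y →
      Complex.VerticalIntegrable (fun s => (y : ℂ) ^ (-s) *
        meijerKernel d 0 (fun j : Fin 0 => j.elim0) (fun _ : Fin d => 0) s) c ∧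
      (meijerGZero d c y).im = 0 ∧ 0 ≤ (meijerGZero d c y).re) ∧
    ∀ᵐ t ∂P.map θ,
      (∀ r, condDistrib (fun ω => ∏ h, β ω h r (m h)) θ P t =
        volume.withDensity fun x => ENNReal.ofReal
          (productGaussianDensity c (fun h => S t h r (m h) (m h)) x)) ∧
      condDistrib (fun ω => ∑ r, ∏ h, β ω h r (m h)) θ P t =
        measureConvList (List.ofFn fun r => condDistrib (fun ω => ∏ h, β ω h r (m h)) θ P t) ∧
      condDistrib (fun ω => ∑ r, ∏ h, β ω h r (m h)) θ P t =
        volume.withDensity (densityConvList (List.ofFn fun r x => ENNReal.ofReal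
          (productGaussianDensity c (fun h => S t h r (m h) (m h)) x))) := by
  refine ⟨fun y hy => ⟨verticalIntegrable_cpow_neg_mul_meijerKernel_zero hd hc hy,
    meijerGZero_im hd hc hy, meijerGZero_re_nonneg hd hc hy⟩, ?_⟩
  have hsummand : Measurable fun (b : (h : Fin d) → Fin R → EuclideanSpace ℝ (Fin (I h))) r =>
    ∏ h, b h r (m h) := by fun_prop
  filter_upwards [ae_condDistrib_of_map_eq_pi hβ hsummand, law_β, hS] with t hcond hlaw hSt
  have hprob := fun r => isProbabilityMeasure_productGaussianDensity hd hc fun h => (hSt h r).2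
  obtain ⟨hterm, hentry⟩ :=
    hcond _ (hlaw ▸ map_prod_eval_pi_pi_multivariateGaussian hd hc m hSt)
  exact ⟨hterm, by simpa only [hterm] using hentry,
    hentry.trans (measureConvList_ofFn_withDensity hR fun r =>
      (aemeasurable_productGaussianDensity hd hc fun h => (hSt h r).2).ennreal_ofReal)⟩

theorem lemma2 {Ω : Type*} [MeasurableSpace Ω] (P : Measure Ω) [IsProbabilityMeasure P]
    {R : ℕ} (hR : 0 < R) {I : Fin 4 → ℕ} {α aτ bτ al bl : ℝ}
    (hα : 0 < α) (haτ : 0 < aτ) (hbτ : 0 < bτ) (hal : 0 < al) (hbl : 0 < bl)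
    (φ : Ω → Fin R → ℝ) (τ : Ω → ℝ) (lam : Ω → Fin 4 → Fin R → ℝ)
    (w : Ω → LocalScales R I) (β : Ω → ParafacMarginals R I)
    (hprior : IsGlobalLocalPrior P α aτ bτ al bl φ τ lam w β)
    (m : (h : Fin 4) → Fin (I h)) (c : ℝ) (hc : 0 < c) :
    -- the Mellin-Barnes integral converges and is real and nonnegative
    (∀ y : ℝ, 0 < y →
      Complex.VerticalIntegrable (fun s => (y : ℂ) ^ (-s) *
        meijerKernel 4 0 (fun j : Fin 0 => j.elim0) (fun _ : Fin 4 => 0) s) c ∧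
      (meijerG₄ c y).im = 0 ∧ 0 ≤ (meijerG₄ c y).re) ∧
    -- the conditional laws given `θ = (τ, φ, W)`
    ∀ᵐ θ ∂(P.map fun ω => (τ ω, φ ω, w ω)),
      (0 < θ.1 ∧ (∀ r, 0 < θ.2.1 r) ∧ ∀ h r p, 0 < θ.2.2 h r p) ∧
      (∀ r, condDistrib (fun ω => parafacSummand m (β ω) r) (fun ω => (τ ω, φ ω, w ω)) P θ =
        volume.withDensity fun x => ENNReal.ofReal
          (productNormalDensity c (fun h => θ.1 * θ.2.1 r * θ.2.2 h r (m h)) x)) ∧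
      condDistrib (fun ω => parafacEntry m (β ω)) (fun ω => (τ ω, φ ω, w ω)) P θ =
        measureConvList (List.ofFn fun r =>
          condDistrib (fun ω => parafacSummand m (β ω) r) (fun ω => (τ ω, φ ω, w ω)) P θ) ∧
      condDistrib (fun ω => parafacEntry m (β ω)) (fun ω => (τ ω, φ ω, w ω)) P θ =
        volume.withDensity (densityConvList (List.ofFn fun r x => ENNReal.ofReal
          (productNormalDensity c (fun h => θ.1 * θ.2.1 r * θ.2.2 h r (m h)) x))) := by
  obtain ⟨hG, hlaw⟩ := lemma2_general hR four_ne_zero hprior.measurable_β.aemeasurable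
    hprior.law_β m (hprior.ae_posSemidef_covariance hα hal hbl m) hc
  simp only [Matrix.smul_apply, Matrix.diagonal_apply_eq, smul_eq_mul] at hlaw
  exact ⟨hG, (hprior.ae_pos hα hal hbl).and hlaw⟩
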